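/- Let $[0]_{p,q}=0$ and $[n]_{p,q}=p^{n-1}+p^{n-2}q+\cdots+pq^{n-2}+q^{n-1}$ for $n\ge 1$, and put $b_n=y[n+1]_{p,q}+[n]_{p,q}$ for $n\ge 0$ and $\lambda_n=y[n]_{p,q}^2$ for $n\ge 1$. Let $$F(q,p,x,y)=\cfrac{1}{1-b_0x-\cfrac{\lambda_1x^2}{1-b_1x-\cfrac{\lambda_2x^2}{1-b_2x-\cfrac{\lambda_3x^2}{\ddots}}}},$$ regarded as a formal power series in $x$ with coefficients in $\mathbb{Z}[q,p,y]$ (the limit of the finite convergents, each of its coefficients being eventually constant along them). For a permutation $\sigma$ of $[n]=\{1,\dots,n\}$, the number of weak exceedances is $|\{j : \sigma(j)\ge j\}|$; the number of crossings is the number of pairs $(i,j)\in[n]^2$ with $j<i\le\sigma(j)<\sigma(i)$ plus the number of pairs $(i,j)$ with $j>i>\sigma(j)>\sigma(i)$; the number of nestings is the number of pairs $(i,j)$ with $j<i\le\sigma(i)<\sigma(j)$ plus the number of pairs $(i,j)$ with $j>i>\sigma(i)>\sigma(j)$. Then for all integers $n,k,\ell,m\ge 0$, the coefficient of $x^n y^k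 q^\ell p^m$ in $F(q,p,x,y)$ equals the number of permutations of $[n]$ with exactly $k$ weak exceedances, $\ell$ crossings and $m$ nestings. -/

import Mathlib

/-! ### J-fractions as formal power series -/

namespace JFraction

variable {R : Type*} [CommRing R]

open PowerSeries

/-- The `N`-th convergent of the J-fraction with coefficients `b₀, b₁, …` and `lam₁, lam₂, …`
(the value `lam 0` is never used):
`1 / (1 - b₀ x - lam₁ x² / (1 - b₁ x - lam₂ x² / ( ⋯ / (1 - b_{N-1} x))))`,
a formal power series in `x` over `R`.  The denominators have constant term `1`, so they are
invertible as power series. -/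
noncomputable def convergent : ℕ → (ℕ → R) → (ℕ → R) → PowerSeries R
  | 0, _, _ => 0
  | N + 1, b, lam =>
      invOfUnit (1 - C (b 0) * X
        - C (lam 1) * X ^ 2 * convergent N (fun i => b (i + 1)) (fun i => lam (i + 1))) 1

/-- The infinite J-fraction
`1 / (1 - b₀ x - lam₁ x² / (1 - b₁ x - lam₂ x² / (1 - b₂ x - ⋯)))`:
the `x`-adic limit of its convergents.  The coefficient of `x ^ n` is the same in all convergents
of index larger than `n`, see `coeff_convergent`. -/
noncomputable def jFraction (b lam : ℕ → R) : PowerSeries R :=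
  PowerSeries.mk fun n => coeff n (convergent (n + 1) b lam)

theorem convergent_succ_mul (N : ℕ) (b lam : ℕ → R) :
    (1 - C (b 0) * X
      - C (lam 1) * X ^ 2 * convergent N (fun i => b (i + 1)) (fun i => lam (i + 1)))
      * convergent (N + 1) b lam = 1 := by
  rw [convergent]
  apply mul_invOfUnit
  simp

theorem X_pow_dvd_convergent_sub (N : ℕ) : ∀ (M : ℕ) (_ : N ≤ M) (b lam : ℕ → R),
    (X : PowerSeries R) ^ (2 * N) ∣ convergent M b lam - convergent N b lam := by
  induction N with
  | zero => intro M _ b lam; simp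
  | succ N ih =>
    intro M hM b lam
    obtain ⟨M, rfl⟩ : ∃ K, M = K + 1 := ⟨M - 1, by omega⟩
    obtain ⟨d, hd⟩ := ih M (by omega) (fun i => b (i + 1)) (fun i => lam (i + 1))
    have h1 := convergent_succ_mul M b lam
    have h2 := convergent_succ_mul N b lam
    refine ⟨C (lam 1) * d * convergent (M + 1) b lam * convergent (N + 1) b lam, ?_⟩
    have hd' := sub_eq_iff_eq_add.mp hd
    rw [hd'] at h1
    generalize convergent (M + 1) b lam = P at *
    generalize convergent (N + 1) b lam = Q at *
    rw [show 2 * (N + 1) = 2 * N + 2 by ring, pow_add]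
    linear_combination Q * h1 - P * h2

/-- The coefficient of `x ^ n` in the convergents is stationary. -/
theorem coeff_convergent {n N : ℕ} (h : n < N) (b lam : ℕ → R) :
    coeff n (convergent N b lam) = coeff n (jFraction b lam) := by
  rw [jFraction, coeff_mk]
  have := X_pow_dvd_iff.mp (X_pow_dvd_convergent_sub (n + 1) N h b lam) n (by omega)
  rwa [map_sub, sub_eq_zero] at this

open scoped PowerSeries.WithPiTopology in
/-- The convergents converge coefficientwise to the J-fraction. -/
theorem tendsto_convergent [TopologicalSpace R] (b lam : ℕ → R) :
    Filter.Tendsto (fun N => convergent N b lam) Filter.atTop (nhds (jFraction b lam)) := by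
  rw [PowerSeries.WithPiTopology.tendsto_iff_coeff_tendsto]
  intro n
  refine tendsto_const_nhds.congr' ?_
  filter_upwards [Filter.eventually_gt_atTop n] with N hN
  exact (coeff_convergent hN b lam).symm

/-- The defining relation of the continued fraction. -/
theorem jFraction_mul (b lam : ℕ → R) :
    (1 - C (b 0) * X
      - C (lam 1) * X ^ 2 * jFraction (fun i => b (i + 1)) (fun i => lam (i + 1)))
      * jFraction b lam = 1 := by
  ext n
  have key : ∀ (b lam : ℕ → R) (N : ℕ), n < N →
      (X : PowerSeries R) ^ (n + 1) ∣ jFraction b lam - convergent N b lam := by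
    intro b lam N hN
    rw [X_pow_dvd_iff]
    intro m hm
    rw [map_sub, coeff_convergent (by omega) b lam, sub_self]
  obtain ⟨d, hd⟩ := key b lam (n + 2) (by omega)
  obtain ⟨e, he⟩ := key (fun i => b (i + 1)) (fun i => lam (i + 1)) (n + 1) (by omega)
  have h := convergent_succ_mul (n + 1) b lam
  have : (X : PowerSeries R) ^ (n + 1) ∣ (1 - C (b 0) * X
      - C (lam 1) * X ^ 2 * jFraction (fun i => b (i + 1)) (fun i => lam (i + 1)))
      * jFraction b lam - 1 := by
    refine ⟨(1 - C (b 0) * X - C (lam 1) * X ^ 2 *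
      jFraction (fun i => b (i + 1)) (fun i => lam (i + 1))) * d
      - C (lam 1) * X ^ 2 * e * convergent (n + 1 + 1) b lam, ?_⟩
    linear_combination (1 - C (b 0) * X - C (lam 1) * X ^ 2 *
      jFraction (fun i => b (i + 1)) (fun i => lam (i + 1))) * hd
      - C (lam 1) * X ^ 2 * convergent (n + 1 + 1) b lam * he + h
  have := X_pow_dvd_iff.mp this n (by omega)
  rwa [map_sub, sub_eq_zero] at this

/-- `[n]_{p,q} = p^{n-1} + p^{n-2} q + ⋯ + p q^{n-2} + q^{n-1}`, with `[0]_{p,q} = 0`. -/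
def pqNumber (p q : R) (n : ℕ) : R :=
  ∑ i ∈ Finset.range n, p ^ (n - 1 - i) * q ^ i

/-- The J-fraction with `b_n = y [n+1]_{p,q} + [n]_{p,q}` and `lam_n = y [n]_{p,q}²`,
a power series in `x` over `R`, for elements `q`, `p`, `y` of `R`. -/
noncomputable def genF (q p y : R) : PowerSeries R :=
  jFraction (fun n => y * pqNumber p q (n + 1) + pqNumber p q n)
    (fun n => y * pqNumber p q n ^ 2)

end JFraction

/-! ### Statistics on permutations -/

namespace PermStat

variable {n : ℕ} (s : Equiv.Perm (Fin n))

/-- The number of weak exceedances: `#{j | s j ≥ j}`. -/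
def wex : ℕ := (Finset.univ.filter fun j => j ≤ s j).card

/-- `C₊(i) = {j | j < i ≤ s j < s i}`. -/
def cPlus (i : Fin n) : Finset (Fin n) :=
  Finset.univ.filter fun j => j < i ∧ i ≤ s j ∧ s j < s i

/-- `C₋(i) = {j | j > i > s j > s i}`. -/
def cMinus (i : Fin n) : Finset (Fin n) :=
  Finset.univ.filter fun j => i < j ∧ s j < i ∧ s i < s j

/-- `A₊(i) = {j | j < i ≤ s i < s j}`. -/
def aPlus (i : Fin n) : Finset (Fin n) :=
  Finset.univ.filter fun j => j < i ∧ i ≤ s i ∧ s i < s j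

/-- `A₋(i) = {j | j > i > s i > s j}`. -/
def aMinus (i : Fin n) : Finset (Fin n) :=
  Finset.univ.filter fun j => i < j ∧ s i < i ∧ s j < s i

/-- The number of crossings. -/
def crossings : ℕ := ∑ i, (cPlus s i).card + ∑ i, (cMinus s i).card

/-- The number of nestings. -/
def nestings : ℕ := ∑ i, (aPlus s i).card + ∑ i, (aMinus s i).card

/-- The number of permutations of an `n`-element ordered set with `k` weak exceedances,
`l` crossings and `m` nestings. -/
def numB (n k l m : ℕ) : ℕ :=
  (Finset.univ.filter fun s : Equiv.Perm (Fin n) =>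
    wex s = k ∧ crossings s = l ∧ nestings s = m).card

end PermStat

/-! ### The indeterminates `q`, `p`, `y` of the polynomial ring `ℤ[q, p, y]` -/

noncomputable def qVar : MvPolynomial (Fin 3) ℤ := MvPolynomial.X 0

noncomputable def pVar : MvPolynomial (Fin 3) ℤ := MvPolynomial.X 1

noncomputable def yVar : MvPolynomial (Fin 3) ℤ := MvPolynomial.X 2

/-- The exponent of the monomial `q ^ l * p ^ m * y ^ k`. -/
noncomputable def qpyExponent (l m k : ℕ) : Fin 3 →₀ ℕ :=
  Finsupp.single 0 l + Finsupp.single 1 m + Finsupp.single 2 k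

/-! Both sides are weighted sums over Motzkin paths. On the algebraic side, `coeff_jFraction`
identifies the coefficients of a J-fraction with weighted counts of paths that return to height 0.
On the combinatorial side, a permutation is built by reading t = 0, 1, ... simultaneously as a
position and as a value. Once everything below t is read, the known part of the graph is a partial
matching π, which leaves equally many positions and values open; their number h = t - #π is the
height. There are four kinds of t. If s t and s⁻¹ t both exceed t, the path goes up with weight 1.
If s⁻¹ t ≤ t ≤ s t, value t takes one of the h open positions or t itself, with weight y[h+1]. If s
t < t < s⁻¹ t, position t takes an open value, with weight [h]. If both are below t, both choices
are made, with weight y[h]². The two level weights add up to `b_h`, and the last is `λ_h`. The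
bracket arises because open elements above the chosen one count crossings and those below count
nestings (`sum_pow_rank`). The recursion is `extensionSum_succ`, and `prod_stepWeight` recovers the
global statistics from the local weights. -/

namespace JFraction

open PowerSeries

variable {R : Type*} [CommRing R]

/-! ### J-fractions and Motzkin paths -/

/-- The sum of the weights of the Motzkin paths of `n` steps from height `h` to height `0`, where
a level step at height `i` has weight `b i`, a down step from height `i` has weight `lam i`, and
up steps have weight `1`. -/
def motzkinSum (b lam : ℕ → R) : ℕ → ℕ → R
  | 0, 0 => 1
  | 0, _ + 1 => 0
  | n + 1, 0 => b 0 * motzkinSum b lam n 0 + motzkinSum b lam n 1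
  | n + 1, h + 1 => b (h + 1) * motzkinSum b lam n (h + 1) + motzkinSum b lam n (h + 2)
      + lam (h + 1) * motzkinSum b lam n h

/-- The generating function of the Motzkin paths from height `h` to height `0`, as a product of
shifted J-fractions. -/
noncomputable def motzkinSeries (b lam : ℕ → R) : ℕ → PowerSeries R
  | 0 => jFraction b lam
  | h + 1 => C (lam (h + 1)) * X
      * jFraction (fun i => b (i + (h + 1))) (fun i => lam (i + (h + 1))) * motzkinSeries b lam h

theorem motzkinSeries_zero_eq (b lam : ℕ → R) :
    motzkinSeries b lam 0
      = 1 + X * (C (b 0) * motzkinSeries b lam 0 + motzkinSeries b lam 1) := by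
  have h := jFraction_mul b lam
  simp only [motzkinSeries, zero_add]
  linear_combination h

/-- The product form cuts a path at its first descent from `h + 1` to `h`; multiplying the
J-fraction relation at level `h + 1` by the remaining factors turns it into the first-step
recursion. -/
theorem motzkinSeries_succ_eq (b lam : ℕ → R) (h : ℕ) :
    motzkinSeries b lam (h + 1)
      = X * (C (b (h + 1)) * motzkinSeries b lam (h + 1) + motzkinSeries b lam (h + 2)
        + C (lam (h + 1)) * motzkinSeries b lam h) := by
  have e := jFraction_mul (fun i => b (i + (h + 1))) (fun i => lam (i + (h + 1)))
  simp only [motzkinSeries]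
  simp only [zero_add, show ∀ i, i + 1 + (h + 1) = i + (h + 1 + 1) from fun i => by ring] at e
  linear_combination C (lam (h + 1)) * X * motzkinSeries b lam h * e

theorem coeff_motzkinSeries (b lam : ℕ → R) (n h : ℕ) :
    coeff n (motzkinSeries b lam h) = motzkinSum b lam n h := by
  induction n generalizing h with
  | zero =>
    cases h with
    | zero => rw [motzkinSeries_zero_eq]; simp [motzkinSum]
    | succ h => rw [motzkinSeries_succ_eq]; simp [motzkinSum]
  | succ n ih =>
    cases h with
    | zero =>
      rw [motzkinSeries_zero_eq]
      simp [motzkinSum, coeff_succ_X_mul, coeff_one, ih]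
    | succ h =>
      rw [motzkinSeries_succ_eq]
      simp [motzkinSum, coeff_succ_X_mul, ih]

theorem coeff_jFraction (b lam : ℕ → R) (n : ℕ) :
    coeff n (jFraction b lam) = motzkinSum b lam n 0 :=
  coeff_motzkinSeries b lam n 0

/-! ### The bracket as a sum over ranks -/

theorem pqNumber_succ (p q : R) (n : ℕ) : pqNumber p q (n + 1) = p ^ n + q * pqNumber p q n := by
  rw [pqNumber, Finset.sum_range_succ', pqNumber, Finset.mul_sum, add_comm]
  congr 1
  · simp
  · refine Finset.sum_congr rfl fun i _ => ?_
    rw [show n + 1 - 1 - (i + 1) = n - 1 - i by omega]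
    ring

-- A new maximum `a` contributes `p ^ #S` itself and multiplies every older term by `q`, which is
-- the recursion `pqNumber_succ`.
open Finset in
theorem sum_pow_rank {α : Type*} [LinearOrder α] (p q : R) (S : Finset α) :
    ∑ s ∈ S, q ^ #{x ∈ S | s < x} * p ^ #{x ∈ S | x < s} = pqNumber p q #S := by
  induction S using Finset.induction_on_max with
  | empty => simp [pqNumber]
  | insert a S ha ih =>
    have haS : a ∉ S := fun h => lt_irrefl a (ha a h)
    rw [sum_insert haS, card_insert_of_notMem haS, pqNumber_succ, ← ih, mul_sum]
    congr 1
    · rw [filter_insert, filter_insert, if_neg (lt_irrefl a), if_neg (lt_irrefl a),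
        filter_true_of_mem ha, filter_false_of_mem fun x hx => (ha x hx).not_gt]
      simp
    · refine sum_congr rfl fun s hs => ?_
      rw [filter_insert, filter_insert, if_pos (ha s hs), if_neg (ha s hs).not_gt,
        card_insert_of_notMem (by simp [haS])]
      ring

end JFraction

namespace PermStat

open Finset JFraction

variable {N : ℕ} {R : Type*} [CommRing R]

/-! ### Partial matchings and their open positions and values -/

/-- The part of the graph of `s` that lies in `{0, …, t - 1}²`. -/
def truncGraph (t : ℕ) (s : Equiv.Perm (Fin N)) : Finset (Fin N × Fin N) :=
  univ.filter fun x => s x.1 = x.2 ∧ x.1.val < t ∧ x.2.val < t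

/-- `π` is the graph of a partial injection of `{0, …, t - 1}` to itself. -/
structure IsPartialMatching (t : ℕ) (π : Finset (Fin N × Fin N)) : Prop where
  lt : ∀ j v, (j, v) ∈ π → j.val < t ∧ v.val < t
  fst_inj : ∀ j v v', (j, v) ∈ π → (j, v') ∈ π → v = v'
  snd_inj : ∀ j j' v, (j, v) ∈ π → (j', v) ∈ π → j = j'

/-- The positions below `t` that `π` leaves unmatched. -/
def openPos (t : ℕ) (π : Finset (Fin N × Fin N)) : Finset (Fin N) :=
  univ.filter fun j => j.val < t ∧ ∀ v, (j, v) ∉ π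

/-- The values below `t` that `π` leaves unmatched. -/
def openVal (t : ℕ) (π : Finset (Fin N × Fin N)) : Finset (Fin N) :=
  univ.filter fun v => v.val < t ∧ ∀ j, (j, v) ∉ π

theorem truncGraph_eq_iff {t : ℕ} {s : Equiv.Perm (Fin N)} {π : Finset (Fin N × Fin N)} :
    truncGraph t s = π ↔ ∀ j v, (j, v) ∈ π ↔ s j = v ∧ j.val < t ∧ v.val < t := by
  simp only [Finset.ext_iff, truncGraph, mem_filter, mem_univ, true_and, Prod.forall]
  exact forall₂_congr fun j v => iff_comm

theorem mem_openPos_iff {t : ℕ} {s : Equiv.Perm (Fin N)} {π : Finset (Fin N × Fin N)}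
    (h : truncGraph t s = π) (j : Fin N) : j ∈ openPos t π ↔ j.val < t ∧ t ≤ (s j).val := by
  rw [truncGraph_eq_iff] at h
  simp only [openPos, mem_filter, mem_univ, true_and, h]
  grind

theorem mem_openVal_iff {t : ℕ} {s : Equiv.Perm (Fin N)} {π : Finset (Fin N × Fin N)}
    (h : truncGraph t s = π) (v : Fin N) :
    v ∈ openVal t π ↔ v.val < t ∧ t ≤ (s.symm v).val := by
  rw [truncGraph_eq_iff] at h
  simp only [openVal, mem_filter, mem_univ, true_and, h]
  constructor
  · rintro ⟨h1, h2⟩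
    refine ⟨h1, ?_⟩
    have := h2 (s.symm v)
    simp at this
    omega
  · rintro ⟨h1, h2⟩
    refine ⟨h1, ?_⟩
    rintro j ⟨rfl, h3, -⟩
    simp at h2
    omega

theorem card_filter_val_lt {t : ℕ} (ht : t ≤ N) : #{j : Fin N | j.val < t} = t := by
  rw [Fin.card_filter_val_lt]; omega

theorem IsPartialMatching.card_openPos {t : ℕ} (ht : t ≤ N) {π : Finset (Fin N × Fin N)}
    (h : IsPartialMatching t π) : #(openPos t π) + #π = t := by
  have h1 : #(π.image Prod.fst) = #π := by
    refine card_image_of_injOn ?_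
    rintro ⟨a, b⟩ hx ⟨c, d⟩ hy (rfl : a = c)
    rw [h.fst_inj _ _ _ hx hy]
  rw [← h1, ← card_union_of_disjoint]
  · refine Eq.trans ?_ (card_filter_val_lt ht)
    congr 1
    ext j
    have := h.lt j
    simp [openPos]
    grind
  · rw [disjoint_left]
    simp [openPos]

theorem IsPartialMatching.card_openVal {t : ℕ} (ht : t ≤ N) {π : Finset (Fin N × Fin N)}
    (h : IsPartialMatching t π) : #(openVal t π) + #π = t := by
  have h1 : #(π.image Prod.snd) = #π := by
    refine card_image_of_injOn ?_
    rintro ⟨a, b⟩ hx ⟨c, d⟩ hy (rfl : b = d)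
    rw [h.snd_inj _ _ _ hx hy]
  rw [← h1, ← card_union_of_disjoint]
  · refine Eq.trans ?_ (card_filter_val_lt ht)
    congr 1
    ext j
    have := fun i => h.lt i j
    simp [openVal]
    grind
  · rw [disjoint_left]
    simp [openVal]

theorem IsPartialMatching.succ {t : ℕ} {π : Finset (Fin N × Fin N)}
    (h : IsPartialMatching t π) : IsPartialMatching (t + 1) π :=
  ⟨fun j v hx => by have := h.lt j v hx; omega, h.fst_inj, h.snd_inj⟩

theorem IsPartialMatching.insert_pair {t : ℕ} {π : Finset (Fin N × Fin N)}
    (h : IsPartialMatching t π) {j v : Fin N} (hj : j ∈ openPos t π) (hv : v ∈ openVal t π) :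
    IsPartialMatching t (insert (j, v) π) := by
  simp only [openPos, openVal, mem_filter, mem_univ, true_and] at hj hv
  obtain ⟨h1, h2, h3⟩ := h
  constructor <;> simp only [mem_insert, Prod.mk.injEq] <;> grind

theorem IsPartialMatching.openPos_succ {t : Fin N} {π : Finset (Fin N × Fin N)}
    (h : IsPartialMatching t π) : openPos (t + 1) π = insert t (openPos t π) := by
  ext j
  have := h.lt j
  simp only [openPos, mem_filter, mem_univ, true_and, mem_insert, Fin.ext_iff]
  grind

theorem IsPartialMatching.openVal_succ {t : Fin N} {π : Finset (Fin N × Fin N)}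
    (h : IsPartialMatching t π) : openVal (t + 1) π = insert t (openVal t π) := by
  ext v
  have := fun i => h.lt i v
  simp only [openVal, mem_filter, mem_univ, true_and, mem_insert, Fin.ext_iff]
  grind

theorem notMem_openPos (t : Fin N) (π : Finset (Fin N × Fin N)) : t ∉ openPos t π := by
  simp [openPos]

/-! ### Local weights -/

/-- The contribution of `t` to the weight of `s`: as a value that is hit from a position `≤ t`,
and as a position that is mapped to a value `< t`. -/
def stepWeight (p q y : R) (s : Equiv.Perm (Fin N)) (t : Fin N) : R :=
  (if s.symm t ≤ t then y else 1)
    * (q ^ #{x | s.symm t < x ∧ x ≤ t ∧ t < s x}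
      * p ^ #{x | x < s.symm t ∧ s.symm t ≤ t ∧ t < s x})
    * (q ^ #(cMinus s t) * p ^ #(aMinus s t))

/-- The weight of the choice of `a` from `S`. -/
def rankWeight (p q : R) (S : Finset (Fin N)) (a : Fin N) : R :=
  q ^ #{x ∈ S | a < x} * p ^ #{x ∈ S | x < a}

theorem sum_rankWeight (p q : R) (S : Finset (Fin N)) :
    ∑ a ∈ S, rankWeight p q S a = pqNumber p q #S := sum_pow_rank p q S

section steps

variable {t : Fin N} {s : Equiv.Perm (Fin N)} {π : Finset (Fin N × Fin N)}

/-- Here `t` is itself a candidate preimage of `t`, since `t ≤ s t`. Every other candidate is sent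
strictly beyond `t`, so candidates to the right of `s.symm t` are counted by `q` and those to the
left by `p`. -/
theorem upper_weight_of_le (p q : R) (h : truncGraph t s = π) (h1 : s.symm t ≤ t) (h2 : t ≤ s t) :
    q ^ #{x | s.symm t < x ∧ x ≤ t ∧ t < s x} * p ^ #{x | x < s.symm t ∧ s.symm t ≤ t ∧ t < s x}
      = rankWeight p q (insert t (openPos t π)) (s.symm t) := by
  have key : ∀ x, x ≠ s.symm t → s x ≠ t := fun x hx e => hx (by simp [← e])
  have e1 : ({x | s.symm t < x ∧ x ≤ t ∧ t < s x} : Finset (Fin N))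
      = {x ∈ insert t (openPos t π) | s.symm t < x} := by
    ext x
    have := key x
    simp only [mem_filter, mem_univ, true_and, mem_insert, mem_openPos_iff h]
    grind
  have e2 : ({x | x < s.symm t ∧ s.symm t ≤ t ∧ t < s x} : Finset (Fin N))
      = {x ∈ insert t (openPos t π) | x < s.symm t} := by
    ext x
    have := key x
    simp only [mem_filter, mem_univ, true_and, mem_insert, mem_openPos_iff h]
    grind
  rw [e1, e2, rankWeight]

theorem upper_weight_of_lt (p q : R) (h : truncGraph t s = π) (h1 : s.symm t ≤ t) (h2 : s t < t) :
    q ^ #{x | s.symm t < x ∧ x ≤ t ∧ t < s x} * p ^ #{x | x < s.symm t ∧ s.symm t ≤ t ∧ t < s x}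
      = rankWeight p q (openPos t π) (s.symm t) := by
  have key : ∀ x, x ≠ s.symm t → s x ≠ t := fun x hx e => hx (by simp [← e])
  have e1 : ({x | s.symm t < x ∧ x ≤ t ∧ t < s x} : Finset (Fin N))
      = {x ∈ openPos t π | s.symm t < x} := by
    ext x
    have := key x
    simp only [mem_filter, mem_univ, true_and, mem_openPos_iff h]
    grind
  have e2 : ({x | x < s.symm t ∧ s.symm t ≤ t ∧ t < s x} : Finset (Fin N))
      = {x ∈ openPos t π | x < s.symm t} := by
    ext x
    have := key x
    simp only [mem_filter, mem_univ, true_and, mem_openPos_iff h]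
    grind
  rw [e1, e2, rankWeight]

theorem upper_weight_of_not_le (p q : R) (h1 : t < s.symm t) :
    q ^ #{x | s.symm t < x ∧ x ≤ t ∧ t < s x} * p ^ #{x | x < s.symm t ∧ s.symm t ≤ t ∧ t < s x}
      = 1 := by
  rw [filter_false_of_mem, filter_false_of_mem]
  · simp
  · intro x _ hx; exact hx.2.1.not_gt h1
  · intro x _ hx; exact (hx.1.trans_le hx.2.1).not_gt h1

theorem lower_weight_of_lt (p q : R) (h : truncGraph t s = π) (h2 : s t < t) :
    q ^ #(cMinus s t) * p ^ #(aMinus s t) = rankWeight p q (openVal t π) (s t) := by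
  have key : ∀ v, v ≠ s t → s.symm v ≠ t := fun x hx e => hx (by simp [← e])
  -- The statistics count positions, the open set consists of values; `s` carries one to the other.
  have e1 : (cMinus s t).map s.toEmbedding = {x ∈ openVal t π | s t < x} := by
    ext v
    have := key v
    simp only [cMinus, mem_map_equiv, mem_filter, mem_univ, true_and, mem_openVal_iff h,
      Equiv.apply_symm_apply]
    grind
  have e2 : (aMinus s t).map s.toEmbedding = {x ∈ openVal t π | x < s t} := by
    ext v
    have := key v
    simp only [aMinus, mem_map_equiv, mem_filter, mem_univ, true_and, mem_openVal_iff h,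
      Equiv.apply_symm_apply]
    grind
  rw [rankWeight, ← e1, ← e2, card_map, card_map]

theorem lower_weight_of_le (p q : R) (h2 : t ≤ s t) :
    q ^ #(cMinus s t) * p ^ #(aMinus s t) = 1 := by
  rw [cMinus, aMinus, filter_false_of_mem, filter_false_of_mem]
  · simp
  · intro x _ hx; exact hx.2.1.not_ge h2
  · intro x _ hx; exact (hx.2.2.trans hx.2.1).not_ge h2

/-- This and the next three lemmas encode the type of `t` and the choices made there as one
condition on the truncation at `t + 1`. Passing from `t` to `t + 1` adds at most the pairs `(s.symm
t, t)` and `(t, s t)`, and since `π` lies below `t`, the new pairs can be read off again. -/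
theorem truncGraph_up (hπ : IsPartialMatching t π) :
    (truncGraph t s = π ∧ ¬ s.symm t ≤ t ∧ t ≤ s t) ↔ truncGraph (t + 1) s = π := by
  have k1 := s.apply_symm_apply t
  have k2 := s.symm_apply_apply t
  have h0 := hπ.lt
  simp only [truncGraph_eq_iff]
  constructor
  · rintro ⟨h1, h2, h3⟩ j v
    have k3 : s j = t ↔ j = s.symm t := s.eq_symm_apply.symm
    rw [h1]
    grind
  · intro h
    have h4 := h (s.symm t) t
    have h5 := h t (s t)
    refine ⟨fun j v => ?_, ?_, ?_⟩ <;> grind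

theorem truncGraph_level_upper (hπ : IsPartialMatching t π) {j : Fin N}
    (hj : j ∈ insert t (openPos t π)) :
    ((truncGraph t s = π ∧ s.symm t ≤ t ∧ t ≤ s t) ∧ s.symm t = j)
      ↔ truncGraph (t + 1) s = insert (j, t) π := by
  have k1 := s.apply_symm_apply t
  have k2 := s.symm_apply_apply t
  have h0 := hπ.lt
  simp only [openPos, mem_insert, mem_filter, mem_univ, true_and] at hj
  simp only [truncGraph_eq_iff, mem_insert, Prod.mk.injEq]
  constructor
  · rintro ⟨⟨h1, h2, h3⟩, rfl⟩ j v
    have k3 : s j = t ↔ j = s.symm t := s.eq_symm_apply.symm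
    rw [h1]
    grind
  · intro h
    have h4 := h (s.symm t) t
    have h5 := h t (s t)
    have h6 := h j t
    have h7 : s.symm t = j := by grind
    refine ⟨⟨fun j v => ?_, ?_, ?_⟩, h7⟩
    · have := h j v
      grind
    · grind
    · grind

theorem truncGraph_level_lower (hπ : IsPartialMatching t π) {v : Fin N}
    (hv : v ∈ openVal t π) :
    ((truncGraph t s = π ∧ ¬ s.symm t ≤ t ∧ ¬ t ≤ s t) ∧ s t = v)
      ↔ truncGraph (t + 1) s = insert (t, v) π := by
  have k1 := s.apply_symm_apply t
  have k2 := s.symm_apply_apply t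
  have h0 := hπ.lt
  simp only [openVal, mem_filter, mem_univ, true_and] at hv
  simp only [truncGraph_eq_iff, mem_insert, Prod.mk.injEq]
  constructor
  · rintro ⟨⟨h1, h2, h3⟩, rfl⟩ j v
    have k3 : s j = t ↔ j = s.symm t := s.eq_symm_apply.symm
    rw [h1]
    grind
  · intro h
    have h4 := h (s.symm t) t
    have h5 := h t (s t)
    have h6 := h t v
    have h7 : s t = v := by grind
    refine ⟨⟨fun j v => ?_, ?_, ?_⟩, h7⟩
    · have := h j v
      grind
    · grind
    · grind

theorem truncGraph_down (hπ : IsPartialMatching t π) {j v : Fin N}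
    (hj : j ∈ openPos t π) (hv : v ∈ openVal t π) :
    ((truncGraph t s = π ∧ s.symm t ≤ t ∧ ¬ t ≤ s t) ∧ (s.symm t, s t) = (j, v))
      ↔ truncGraph (t + 1) s = insert (j, t) (insert (t, v) π) := by
  have k1 := s.apply_symm_apply t
  have k2 := s.symm_apply_apply t
  have h0 := hπ.lt
  simp only [openPos, openVal, mem_filter, mem_univ, true_and] at hj hv
  simp only [truncGraph_eq_iff, mem_insert, Prod.mk.injEq]
  constructor
  · rintro ⟨⟨h1, h2, h3⟩, rfl, rfl⟩ j v
    have k3 : s j = t ↔ j = s.symm t := s.eq_symm_apply.symm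
    rw [h1]
    grind
  · intro h
    have h4 := h j t
    have h5 := h t v
    have h7 : s.symm t = j := by grind
    have h8 : s t = v := by grind
    refine ⟨⟨fun j v => ?_, ?_, ?_⟩, h7, h8⟩
    · have := h j v
      grind
    · grind
    · grind

end steps

theorem IsPartialMatching.insert_pair_pair {t : ℕ} {π : Finset (Fin N × Fin N)}
    (h : IsPartialMatching t π) {j v j' v' : Fin N} (hj : j ∈ openPos t π) (hv : v ∈ openVal t π)
    (hj' : j' ∈ openPos t π) (hv' : v' ∈ openVal t π) (hjj : j ≠ j') (hvv : v ≠ v') :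
    IsPartialMatching t (insert (j', v') (insert (j, v) π)) := by
  refine (h.insert_pair hj hv).insert_pair ?_ ?_
  · simp only [openPos, mem_filter, mem_univ, true_and, mem_insert, Prod.mk.injEq] at hj' ⊢
    grind
  · simp only [openVal, mem_filter, mem_univ, true_and, mem_insert, Prod.mk.injEq] at hv' ⊢
    grind

theorem notMem_of_mem_openPos {t : ℕ} {π : Finset (Fin N × Fin N)} {j : Fin N}
    (hj : j ∈ openPos t π) (v : Fin N) : (j, v) ∉ π :=
  (mem_filter.mp hj).2.2 v

/-! ### The recursion for sums over extensions -/

/-- The sum over the permutations that extend the partial matching `π` of the product of the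
contributions of the elements that are not below `t`. -/
def extensionSum (p q y : R) (t : ℕ) (π : Finset (Fin N × Fin N)) : R :=
  ∑ s : Equiv.Perm (Fin N) with truncGraph t s = π, ∏ i : Fin N with t ≤ i.val, stepWeight p q y s i

theorem prod_stepWeight_eq_mul (p q y : R) (s : Equiv.Perm (Fin N)) (t : Fin N) :
    ∏ i : Fin N with t.val ≤ i.val, stepWeight p q y s i
      = stepWeight p q y s t * ∏ i : Fin N with t.val + 1 ≤ i.val, stepWeight p q y s i := by
  have : ({i : Fin N | t.val ≤ i.val} : Finset (Fin N))
      = insert t ({i : Fin N | t.val + 1 ≤ i.val} : Finset (Fin N)) := by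
    ext i
    simp only [mem_filter, mem_univ, true_and, mem_insert, Fin.ext_iff]
    omega
  rw [this, prod_insert (by simp)]

/-- Summation over a family of disjoint extensions of a partial matching. -/
theorem sum_stepWeight_mul_of_fiber {ι : Type*} [DecidableEq ι] (p q y : R) {t : Fin N}
    (P : Equiv.Perm (Fin N) → Prop) [DecidablePred P] (S : Finset ι)
    (g : Equiv.Perm (Fin N) → ι) (e : ι → Finset (Fin N × Fin N)) (w : ι → R)
    (hS : ∀ s, P s → g s ∈ S)
    (he : ∀ a ∈ S, ∀ s, (P s ∧ g s = a) ↔ truncGraph (t + 1) s = e a)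
    (hw : ∀ s, P s → stepWeight p q y s t = w (g s)) :
    ∑ s : Equiv.Perm (Fin N) with P s, ∏ i : Fin N with t.val ≤ i.val, stepWeight p q y s i
      = ∑ a ∈ S, w a * extensionSum p q y (t + 1) (e a) := by
  rw [← sum_fiberwise_of_maps_to (g := g) (t := S)
    (fun s hs => hS s (by simpa using hs))]
  refine sum_congr rfl fun a ha => ?_
  rw [extensionSum, mul_sum, filter_filter]
  refine sum_congr ?_ fun s hs => ?_
  · ext s
    simp only [mem_filter, mem_univ, true_and]
    exact he a ha s
  · obtain ⟨h1, h2⟩ := (he a ha s).mpr (by simpa using hs)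
    rw [prod_stepWeight_eq_mul, hw s h1, h2]

/-- The summands are the up, upper level, lower level and down steps; a fixed point belongs to the
upper level. -/
theorem extensionSum_succ (p q y : R) {t : Fin N} {π : Finset (Fin N × Fin N)}
    (hπ : IsPartialMatching t π) :
    extensionSum p q y t π
      = extensionSum p q y (t + 1) π
        + ∑ j ∈ openPos (t + 1) π, y * rankWeight p q (openPos (t + 1) π) j
            * extensionSum p q y (t + 1) (insert (j, t) π)
        + ∑ v ∈ openVal t π, rankWeight p q (openVal t π) v
            * extensionSum p q y (t + 1) (insert (t, v) π)
        + ∑ a ∈ openPos t π ×ˢ openVal t π,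
            y * rankWeight p q (openPos t π) a.1 * rankWeight p q (openVal t π) a.2
            * extensionSum p q y (t + 1) (insert (a.1, t) (insert (t, a.2) π)) := by
  have k1 : ∀ s : Equiv.Perm (Fin N), s (s.symm t) = t := fun s => s.apply_symm_apply t
  have k2 : ∀ s : Equiv.Perm (Fin N), s.symm (s t) = t := fun s => s.symm_apply_apply t
  have split : extensionSum p q y t π
      = ∑ s : Equiv.Perm (Fin N) with truncGraph t s = π ∧ ¬ s.symm t ≤ t ∧ t ≤ s t,
          ∏ i : Fin N with t.val ≤ i.val, stepWeight p q y s i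
        + ∑ s : Equiv.Perm (Fin N) with truncGraph t s = π ∧ s.symm t ≤ t ∧ t ≤ s t,
          ∏ i : Fin N with t.val ≤ i.val, stepWeight p q y s i
        + ∑ s : Equiv.Perm (Fin N) with truncGraph t s = π ∧ ¬ s.symm t ≤ t ∧ ¬ t ≤ s t,
          ∏ i : Fin N with t.val ≤ i.val, stepWeight p q y s i
        + ∑ s : Equiv.Perm (Fin N) with truncGraph t s = π ∧ s.symm t ≤ t ∧ ¬ t ≤ s t,
          ∏ i : Fin N with t.val ≤ i.val, stepWeight p q y s i := by
    rw [extensionSum]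
    simp only [sum_filter]
    rw [← sum_add_distrib, ← sum_add_distrib, ← sum_add_distrib]
    refine sum_congr rfl fun s _ => ?_
    by_cases h1 : truncGraph t s = π <;> by_cases h2 : s.symm t ≤ t <;> by_cases h3 : t ≤ s t <;>
      simp [h1, h2, h3]
  rw [split]
  congr 1; congr 1; congr 1
  · rw [sum_stepWeight_mul_of_fiber p q y _ {()} (fun _ => ()) (fun _ => π) (fun _ => 1)]
    · simp
    · simp
    · intro _ _ s
      rw [← truncGraph_up hπ]
      simp
    · rintro s ⟨-, h1, h2⟩
      rw [stepWeight, if_neg h1, upper_weight_of_not_le p q (not_le.mp h1),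
        lower_weight_of_le p q h2]
      simp
  · rw [hπ.openPos_succ]
    refine sum_stepWeight_mul_of_fiber p q y _ _ (fun s => s.symm t) (fun j => insert (j, t) π)
      (fun j => y * rankWeight p q (insert t (openPos t π)) j) ?_ ?_ ?_
    · rintro s ⟨h, h1, h2⟩
      rw [mem_insert, mem_openPos_iff h, k1]
      grind
    · exact fun j hj s => truncGraph_level_upper hπ hj
    · rintro s ⟨h, h1, h2⟩
      rw [stepWeight, if_pos h1, upper_weight_of_le p q h h1 h2, lower_weight_of_le p q h2, mul_one]
  · refine sum_stepWeight_mul_of_fiber p q y _ _ (fun s => s t) (fun v => insert (t, v) π)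
      (fun v => rankWeight p q (openVal t π) v) ?_ ?_ ?_
    · rintro s ⟨h, h1, h2⟩
      rw [mem_openVal_iff h, k2]
      grind
    · exact fun j hj s => truncGraph_level_lower hπ hj
    · rintro s ⟨h, h1, h2⟩
      rw [stepWeight, if_neg h1, upper_weight_of_not_le p q (not_le.mp h1),
        lower_weight_of_lt p q h (not_le.mp h2), mul_one, one_mul]
  · refine sum_stepWeight_mul_of_fiber p q y _ _ (fun s => (s.symm t, s t))
      (fun a => insert (a.1, t) (insert (t, a.2) π))
      (fun a => y * rankWeight p q (openPos t π) a.1 * rankWeight p q (openVal t π) a.2) ?_ ?_ ?_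
    · rintro s ⟨h, h1, h2⟩
      have h3 := k1 s
      rw [mem_product, mem_openVal_iff h, mem_openPos_iff h, k2, k1]
      grind
    · rintro ⟨j, v⟩ ha s
      rw [mem_product] at ha
      exact truncGraph_down hπ ha.1 ha.2
    · rintro s ⟨h, h1, h2⟩
      rw [stepWeight, if_pos h1, upper_weight_of_lt p q h h1 (not_le.mp h2),
        lower_weight_of_lt p q h (not_le.mp h2)]

theorem card_truncGraph_self (s : Equiv.Perm (Fin N)) : #(truncGraph N s) = N := by
  have : truncGraph N s = univ.image fun j => (j, s j) := by
    ext ⟨j, v⟩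
    simp [truncGraph]
  rw [this, card_image_of_injective _ fun a b h => (Prod.mk.inj h).1, card_univ, Fintype.card_fin]

theorem extensionSum_self (p q y : R) {π : Finset (Fin N × Fin N)}
    (hπ : IsPartialMatching N π) :
    extensionSum p q y N π = if #π = N then 1 else 0 := by
  have hprod : ∀ s : Equiv.Perm (Fin N),
      ∏ i : Fin N with N ≤ i.val, stepWeight p q y s i = 1 := fun s => by
    rw [filter_false_of_mem fun i _ => i.isLt.not_ge, prod_empty]
  simp only [extensionSum, hprod]
  split_ifs with h
  -- A matching of full size leaves no position open, so it is the graph of an injective self-map,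
  -- hence of exactly one permutation.
  · have h0 : openPos N π = ∅ := by
      have := hπ.card_openPos le_rfl
      rw [← card_eq_zero]
      omega
    have h1 : ∀ j, ∃ v, (j, v) ∈ π := by
      intro j
      by_contra! hj
      have : j ∈ openPos N π := by simp [openPos, hj]
      simp [h0] at this
    choose f hf using h1
    have hinj : Function.Injective f := fun a b hab =>
      hπ.snd_inj a b (f a) (hf a) (hab ▸ hf b)
    have : ({s | truncGraph N s = π} : Finset (Equiv.Perm (Fin N)))
        = {Equiv.ofBijective f (Finite.injective_iff_bijective.mp hinj)} := by
      ext s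
      simp only [mem_filter, mem_univ, true_and, mem_singleton, truncGraph_eq_iff, Fin.is_lt,
        and_true]
      constructor
      · intro hs
        ext j
        rw [(hs j (f j)).mp (hf j), Equiv.ofBijective_apply]
      · rintro rfl j v
        rw [Equiv.ofBijective_apply]
        exact ⟨fun hj => hπ.fst_inj _ _ _ (hf j) hj, fun hj => hj ▸ hf j⟩
    rw [this, sum_singleton]
  · rw [filter_false_of_mem, sum_empty]
    rintro s - rfl
    exact h (card_truncGraph_self s)

/-- The sum depends on `π` only through the height `t - #π`: adding 0, 1 or 2 pairs while `t` grows
by 1 changes the height by +1, 0 or -1. -/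
theorem extensionSum_eq_motzkinSum (p q y : R) (n t : ℕ) (hn : t + n = N)
    (π : Finset (Fin N × Fin N)) (hπ : IsPartialMatching t π) :
    extensionSum p q y t π
      = motzkinSum (fun n => y * pqNumber p q (n + 1) + pqNumber p q n)
          (fun n => y * pqNumber p q n ^ 2) n (t - #π) := by
  induction n generalizing t π with
  | zero =>
    obtain rfl : t = N := by omega
    have := hπ.card_openPos le_rfl
    rw [extensionSum_self p q y hπ]
    split_ifs with h
    · rw [h, Nat.sub_self, motzkinSum]
    · obtain ⟨d, hd⟩ : ∃ d, t - #π = d + 1 := ⟨t - #π - 1, by omega⟩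
      rw [hd, motzkinSum]
  | succ n ih =>
    lift t to Fin N using by omega
    have c1 := hπ.card_openPos t.isLt.le
    have c2 := hπ.card_openVal t.isLt.le
    have c3 : #(openPos (t + 1) π) + #π = t + 1 := hπ.succ.card_openPos t.isLt
    have tP : t ∈ openPos (t + 1) π := by simp [hπ.openPos_succ]
    have tV : t ∈ openVal (t + 1) π := by simp [hπ.openVal_succ]
    have e1 : ∀ j ∈ openPos (t + 1) π, extensionSum p q y (t + 1) (insert (j, t) π)
        = motzkinSum (fun n => y * pqNumber p q (n + 1) + pqNumber p q n)
          (fun n => y * pqNumber p q n ^ 2) n (t - #π) := fun j hj => by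
      rw [ih (t + 1) (by omega) _ (hπ.succ.insert_pair hj tV),
        card_insert_of_notMem (notMem_of_mem_openPos hj t), Nat.add_sub_add_right]
    have e2 : ∀ v ∈ openVal t π, extensionSum p q y (t + 1) (insert (t, v) π)
        = motzkinSum (fun n => y * pqNumber p q (n + 1) + pqNumber p q n)
          (fun n => y * pqNumber p q n ^ 2) n (t - #π) := fun v hv => by
      rw [ih (t + 1) (by omega) _ (hπ.succ.insert_pair tP (by simp [hπ.openVal_succ, hv])),
        card_insert_of_notMem (notMem_of_mem_openPos tP v), Nat.add_sub_add_right]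
    have e3 : ∀ a ∈ openPos t π ×ˢ openVal t π,
        extensionSum p q y (t + 1) (insert (a.1, t) (insert (t, a.2) π))
        = motzkinSum (fun n => y * pqNumber p q (n + 1) + pqNumber p q n)
          (fun n => y * pqNumber p q n ^ 2) n (t - #π - 1) := by
      rintro ⟨j, v⟩ ha
      obtain ⟨hj, hv⟩ := mem_product.mp ha
      have hjt : t ≠ j := by rintro rfl; exact notMem_openPos _ _ hj
      have hvt : v ≠ t := by rintro rfl; simp [openVal] at hv
      have hj' : j ∈ openPos (t + 1) π := by simp [hπ.openPos_succ, hj]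
      have hv' : v ∈ openVal (t + 1) π := by simp [hπ.openVal_succ, hv]
      rw [ih (t + 1) (by omega) _ (hπ.succ.insert_pair_pair tP hv' hj' tV hjt hvt),
        card_insert_of_notMem, card_insert_of_notMem (notMem_of_mem_openPos tP v),
        Nat.add_sub_add_right, Nat.sub_add_eq]
      simp [hjt.symm, notMem_of_mem_openPos hj]
    rw [extensionSum_succ p q y hπ, ih (t + 1) (by omega) π hπ.succ,
      sum_congr rfl fun j hj => congrArg _ (e1 j hj),
      sum_congr rfl fun v hv => congrArg _ (e2 v hv),
      sum_congr rfl fun a ha => congrArg _ (e3 a ha), ← sum_mul, ← sum_mul, ← sum_mul, ← mul_sum,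
      sum_rankWeight, sum_rankWeight, sum_product]
    simp only [mul_assoc, ← mul_sum, ← sum_mul, sum_rankWeight]
    rw [show #(openPos (t + 1) π) = t - #π + 1 by omega, show #(openPos t π) = t - #π by omega,
      show #(openVal t π) = t - #π by omega, show t.val + 1 - #π = t - #π + 1 by omega]
    -- At height 0 the down term has the truncated height `0 - 1 = 0`, but its coefficient contains
    -- the empty bracket and vanishes.
    rcases t.val - #π with _ | d
    · simp only [motzkinSum, pqNumber, range_zero, sum_empty]
      ring
    · simp only [motzkinSum, Nat.add_sub_cancel]
      ring

theorem sum_prod_stepWeight (p q y : R) (n : ℕ) :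
    ∑ s : Equiv.Perm (Fin n), ∏ i, stepWeight p q y s i = PowerSeries.coeff n (genF q p y) := by
  have h := extensionSum_eq_motzkinSum p q y n 0 (zero_add n) ∅
    ⟨by simp, by simp, by simp⟩
  rw [genF, coeff_jFraction, ← Nat.zero_sub (#(∅ : Finset (Fin n × Fin n))), ← h, extensionSum]
  simp [truncGraph]

/-! ### From local weights to the global statistics -/

theorem wex_eq_card (s : Equiv.Perm (Fin N)) : wex s = #{i | s.symm i ≤ i} := by
  rw [wex, ← card_map s.toEmbedding]
  congr 1
  ext i
  simp [mem_map_equiv]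

/-- A crossing pair `(i, j)` is recorded at `i` on the left and at the value `s j` on the right;
hence the exchange of sums before reindexing by `s.symm`. -/
theorem sum_card_cPlus (s : Equiv.Perm (Fin N)) :
    ∑ i, #(cPlus s i) = ∑ i, #{x | s.symm i < x ∧ x ≤ i ∧ i < s x} := by
  simp only [cPlus, card_filter]
  rw [sum_comm, ← Equiv.sum_comp s.symm]
  simp

/-- No exchange is needed: a nesting is already recorded at `i`, which owns the smaller value `s i`.
-/
theorem sum_card_aPlus (s : Equiv.Perm (Fin N)) :
    ∑ i, #(aPlus s i) = ∑ i, #{x | x < s.symm i ∧ s.symm i ≤ i ∧ i < s x} := by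
  simp only [aPlus]
  rw [← Equiv.sum_comp s.symm]
  simp

theorem prod_stepWeight (p q y : R) (s : Equiv.Perm (Fin N)) :
    ∏ i, stepWeight p q y s i = q ^ crossings s * p ^ nestings s * y ^ wex s := by
  simp only [stepWeight, prod_mul_distrib, prod_pow_eq_pow_sum]
  rw [← sum_card_cPlus, ← sum_card_aPlus, ← prod_filter, prod_const, ← wex_eq_card, crossings,
    nestings, pow_add, pow_add]
  ring

/-- The J-fraction is the generating function of the permutations by weak exceedances, crossings
and nestings. -/
theorem coeff_genF (p q y : R) (n : ℕ) :
    PowerSeries.coeff n (genF q p y)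
      = ∑ s : Equiv.Perm (Fin n), q ^ crossings s * p ^ nestings s * y ^ wex s := by
  rw [← sum_prod_stepWeight]
  exact sum_congr rfl fun s _ => prod_stepWeight p q y s

end PermStat

/-! ### Extraction of coefficients -/

theorem qpyExponent_inj {l m k l' m' k' : ℕ} :
    qpyExponent l m k = qpyExponent l' m' k' ↔ k = k' ∧ l = l' ∧ m = m' := by
  constructor
  · intro h
    have h0 := DFunLike.congr_fun h 0
    have h1 := DFunLike.congr_fun h 1
    have h2 := DFunLike.congr_fun h 2
    simp [qpyExponent] at h0 h1 h2
    exact ⟨h2, h0, h1⟩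
  · rintro ⟨rfl, rfl, rfl⟩
    rfl

theorem pow_mul_pow_mul_pow_eq_monomial (l m k : ℕ) :
    qVar ^ l * pVar ^ m * yVar ^ k = MvPolynomial.monomial (qpyExponent l m k) 1 := by
  simp [qVar, pVar, yVar, qpyExponent, MvPolynomial.X_pow_eq_monomial, MvPolynomial.monomial_mul]

/-- The coefficient of `x ^ n * y ^ k * q ^ l * p ^ m` in the J-fraction is the number of
permutations of `[n]` with `k` weak exceedances, `l` crossings and `m` nestings. -/
theorem mainTheorem3 (n k l m : ℕ) :
    MvPolynomial.coeff (qpyExponent l m k)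
        (PowerSeries.coeff n (JFraction.genF qVar pVar yVar))
      = (PermStat.numB n k l m : ℤ) := by
  rw [PermStat.coeff_genF, MvPolynomial.coeff_sum, PermStat.numB, Finset.card_filter,
    Nat.cast_sum]
  refine Finset.sum_congr rfl fun s _ => ?_
  rw [pow_mul_pow_mul_pow_eq_monomial, MvPolynomial.coeff_monomial]
  simp only [qpyExponent_inj]
  push_cast
  rfl
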